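/- Let $d \ge 1$ and let $\ell : [0,\infty)^d \to \mathbb{R}$ be a stable tail dependence function, i.e., there is a random vector $X=(X_1,\dots,X_d)$ with continuous marginal distribution functions $F_1,\dots,F_d$ such that, for every $x \in [0,\infty)^d$, \[ \ell(x) = \lim_{t \downarrow 0} t^{-1}\, \mathbb{P}\{F_1(X_1) > 1 - t x_1 \text{ or } \dots \text{ or } F_d(X_d) > 1 - t x_d\}. \] Let $k = k_n \in (0,n]$, $n \ge 1$, be real numbers with $\log n = o(k)$ and $k = o(n)$ as $n \to \infty$. For each $n$ let $\hat\ell_{n,k}$ be an estimator of $\ell$: a random real-valued function on $[0,n/k]^d$, defined on a probability space that may depend on $n$, and not assumed to be measurable. Put $B_{n,k} = \sqrt{k}\,(\hat\ell_{n,k} - \ell)$ on $[0,n/k]^d$. For $x \in [0,n/k]^d$ let $\nu_{n,k,x}$ be the law of $(T_1/k,\dots,T_d/k)$, where $T_1,\dots,T_d$ are independent and $T_j \sim \mathrm{Bin}(n, \tfrac{k}{n} x_j)$. Assume: (i) (growth) $\sup_{y \in [0,n/k]^d} |\hat\ell_{n,k}(y)| = O_{\mathbb{P}}(n/k)$ as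 $n \to \infty$; (ii) (weak convergence) there exist $\delta > 0$ and a stochastic process $B$ on $[0,1+\delta]^d$ with continuous trajectories such that $B_{n,k} \leadsto B$ as $n \to \infty$ in $\ell^\infty([0,1+\delta]^d)$, the space of bounded real functions on $[0,1+\delta]^d$ with the supremum norm. Here $\leadsto$ is weak convergence in the sense of Hoffmann-Jørgensen: for large $n$, $B_{n,k}$ restricted to $[0,1+\delta]^d$ is a (possibly non-measurable) map into $\ell^\infty([0,1+\delta]^d)$, the limit $B$ is Borel measurable, and $\mathbb{E}^* f(B_{n,k}) \to \mathbb{E} f(B)$ for every bounded continuous $f : \ell^\infty([0,1+\delta]^d) \to \mathbb{R}$, with $\mathbb{E}^*$ the outer expectation. Then \[ \sup_{x \in [0,1]^d} \left| \int_{[0,n/k]^d} B_{n,k}(y) \, \mathrm{d}\nu_{n,k,x}(y) - B_{n,k}(x) \right| = o_{\mathbb{P}}(1), \qquad n \to \infty. \] The symbols $O_{\mathbb{P}}$ and $o_{\mathbb{P}}$ are understood with outer probability for non-measurable quantities. -/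

import Mathlib

open MeasureTheory Filter Topology Asymptotics
open scoped ENNReal BoundedContinuousFunction

noncomputable section

/-- `ℓ` (only its values on `[0,∞)^d` matter) is a stable tail dependence function: for some random
vector with law `μ` on `ℝ^d` and continuous marginal distribution functions `F_1, …, F_d`,
`ℓ(x) = lim_{t ↓ 0} t⁻¹ μ{z : F_1(z_1) > 1 - t x_1 or … or F_d(z_d) > 1 - t x_d}`
for every `x ∈ [0,∞)^d`. -/
def IsStdf {d : ℕ} (ℓ : (Fin d → ℝ) → ℝ) : Prop :=
  ∃ μ : Measure (Fin d → ℝ), IsProbabilityMeasure μ ∧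
    (∀ j, Continuous fun s : ℝ => ProbabilityTheory.cdf (μ.map fun z => z j) s) ∧
    ∀ x : Fin d → ℝ, 0 ≤ x →
      Tendsto
        (fun t : ℝ =>
          t⁻¹ * μ.real {z | ∃ j, 1 - t * x j < ProbabilityTheory.cdf (μ.map fun z => z j) (z j)})
        (𝓝[>] 0) (𝓝 (ℓ x))

/-- The box `[0,b]^d`. -/
def box (d : ℕ) (b : ℝ) : Set (Fin d → ℝ) := Set.Icc 0 (fun _ => b)

/-- The measure `ν_{n,k,x}`: the law of `(T_1, …, T_d) / k` for independent
`T_j ∼ Bin(n, (k/n) x_j)`. For `x ∈ [0,n/k]^d` the projection to `[0,1]` does nothing to the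
success probabilities. -/
def betaKernel {d : ℕ} (n : ℕ) (k : ℝ) (x : Fin d → ℝ) : Measure (Fin d → ℝ) :=
  (Measure.pi fun j =>
    ProbabilityTheory.binomial n (Set.projIcc (0 : ℝ) 1 zero_le_one (k / n * x j))).map
      fun t j => (t j : ℝ) / k

/-- The Banach space `ℓ^∞(T)` of bounded real functions on `T` with the supremum norm. -/
abbrev LInfty (T : Type*) := lp (fun _ : T => ℝ) ∞

/-- Outer expectation of a bounded function: the infimum of the expectations of its measurable
majorants. (For bounded `g`, real-valued integrable majorants give the same infimum as
extended-real-valued ones whose expectation exists.) -/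
def outerExpectation {Ω : Type*} [MeasurableSpace Ω] (P : Measure Ω) (g : Ω → ℝ) : ℝ :=
  sInf {r | ∃ U : Ω → ℝ, Measurable U ∧ Integrable U P ∧ (∀ ω, g ω ≤ U ω) ∧ r = ∫ ω, U ω ∂P}

/-- Weak convergence in the sense of Hoffmann-Jørgensen of arbitrary (possibly non-measurable) maps
`X n`, each on its own probability space, into a normed space, to a Borel measurable limit `B`:
`E^* f(X n) → E f(B)` for all bounded continuous real `f`. -/
def ConvergesWeakly {E : Type*} [NormedAddCommGroup E]
    {Ω : ℕ → Type*} [∀ n, MeasurableSpace (Ω n)] (P : ∀ n, Measure (Ω n)) (X : ∀ n, Ω n → E)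
    {Ω' : Type*} [MeasurableSpace Ω'] (Q : Measure Ω') (B : Ω' → E) : Prop :=
  @Measurable Ω' E _ (borel E) B ∧
  ∀ f : E →ᵇ ℝ,
    Tendsto (fun n => outerExpectation (P n) fun ω => f (X n ω)) atTop (𝓝 (∫ ω, f (B ω) ∂Q))

/-- `S n = O_P(a n)`, in outer probability when `S n` is not measurable (a `Measure` evaluated at a
non-measurable set is its outer measure). -/
def IsBigOInProb {Ω : ℕ → Type*} [∀ n, MeasurableSpace (Ω n)] (P : ∀ n, Measure (Ω n))
    (S : ∀ n, Ω n → ℝ≥0∞) (a : ℕ → ℝ) : Prop :=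
  ∀ ε : ℝ, 0 < ε → ∃ M : ℝ, ∀ᶠ n in atTop,
    P n {ω | ENNReal.ofReal (M * a n) < S n ω} ≤ ENNReal.ofReal ε

/-- `S n = o_P(1)`, in outer probability when `S n` is not measurable. -/
def IsLittleOOneInProb {Ω : ℕ → Type*} [∀ n, MeasurableSpace (Ω n)] (P : ∀ n, Measure (Ω n))
    (S : ∀ n, Ω n → ℝ≥0∞) : Prop :=
  ∀ ε : ℝ, 0 < ε → Tendsto (fun n => P n {ω | ENNReal.ofReal ε < S n ω}) atTop (𝓝 0)

/-- The normalized estimation error `B_{n,k} = √k (ℓhat_{n,k} - ℓ)`. -/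
def errorProcess {d : ℕ} {Ω : ℕ → Type*} (k : ℕ → ℝ) (ℓhat : ∀ n, Ω n → (Fin d → ℝ) → ℝ)
    (ℓ : (Fin d → ℝ) → ℝ) (n : ℕ) (ω : Ω n) (y : Fin d → ℝ) : ℝ :=
  √(k n) * (ℓhat n ω y - ℓ y)

/-- Growth condition: `sup_{y ∈ [0,n/k]^d} |ℓhat_{n,k}(y)| = O_P(n/k)`. -/
def GrowthCondition {d : ℕ} {Ω : ℕ → Type*} [∀ n, MeasurableSpace (Ω n)]
    (P : ∀ n, Measure (Ω n)) (k : ℕ → ℝ) (ℓhat : ∀ n, Ω n → (Fin d → ℝ) → ℝ) : Prop :=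
  IsBigOInProb P (fun n ω => ⨆ y ∈ box d (n / k n), ‖ℓhat n ω y‖ₑ) (fun n => n / k n)

/-- Weak convergence condition: for some `δ > 0` there is a process `B` on `[0,1+δ]^d`, defined on
`(Ω', Q)`, with continuous trajectories, such that `B_{n,k}` converges weakly to `B` in
`ℓ^∞([0,1+δ]^d)`. Here `Z n` is `B_{n,k}` restricted to `[0,1+δ]^d`, as an element of `ℓ^∞`; this
makes sense for large `n` only, as `B_{n,k}` lives on `[0,n/k]^d`. -/
def WeakConvergenceCondition {d : ℕ} {Ω : ℕ → Type*} [∀ n, MeasurableSpace (Ω n)]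
    (P : ∀ n, Measure (Ω n)) {Ω' : Type*} [MeasurableSpace Ω'] (Q : Measure Ω')
    (k : ℕ → ℝ) (ℓhat : ∀ n, Ω n → (Fin d → ℝ) → ℝ) (ℓ : (Fin d → ℝ) → ℝ) : Prop :=
  ∃ δ : ℝ, 0 < δ ∧ ∃ B : Ω' → LInfty (box d (1 + δ)),
    (∀ ω, Continuous fun y => B ω y) ∧
    ∃ Z : ∀ n, Ω n → LInfty (box d (1 + δ)),
      (∀ᶠ n in atTop, ∀ ω y, Z n ω y = errorProcess k ℓhat ℓ n ω y) ∧
      ConvergesWeakly P Z Q B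

end

/-! The integral averages `B_{n,k}(y) - B_{n,k}(x)` over a random point `y` with mean `x` and
fluctuations of order `k^(-1/2)`. Split it at a fixed distance `r`. Near `x`, weak convergence to a
continuous limit makes the oscillation of `B_{n,k}` small in outer probability
(`ConvergesWeakly.eventually_modulusOfContinuity`). Far from `x`, the growth condition and `|ℓ(y)| ≤
∑ y_j` bound `B_{n,k}` by a multiple of `√k · n/k`, while a Chernoff bound gives the far region mass
at most `2d exp(-k r²/4)`; since `log n = o(k)`, the product vanishes. All bounds are uniform in `x
∈ [0,1]^d`. -/

/-! ### Linear bound on the stable tail dependence function. -/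

/-- Probability integral transform, upper tail. -/
theorem measureReal_one_sub_lt_cdf_le (μ : Measure ℝ) [IsProbabilityMeasure μ]
    (hc : Continuous fun s => ProbabilityTheory.cdf μ s) {s : ℝ} (hs : 0 ≤ s) :
    μ.real {z | 1 - s < ProbabilityTheory.cdf μ z} ≤ s := by
  -- Endpoints are treated apart: a cdf need not attain the values 0 and 1.
  rcases hs.eq_or_lt with rfl | hs0
  · have : {z | 1 - 0 < ProbabilityTheory.cdf μ z} = ∅ := by
      ext z
      simpa using ProbabilityTheory.cdf_le_one μ z
    rw [this]
    simp
  rcases le_or_gt 1 s with h1 | h1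
  · exact measureReal_le_one.trans h1
  obtain ⟨a, ha⟩ : ∃ a, ProbabilityTheory.cdf μ a = 1 - s :=
    mem_range_of_exists_le_of_exists_ge hc
      (((ProbabilityTheory.tendsto_cdf_atBot μ).eventually_le_const (by linarith)).exists)
      (((ProbabilityTheory.tendsto_cdf_atTop μ).eventually_const_le (by linarith)).exists)
  have hsub : {z | 1 - s < ProbabilityTheory.cdf μ z} ⊆ (Set.Iic a)ᶜ := by
    intro z hz hza
    have := ProbabilityTheory.monotone_cdf μ (Set.mem_Iic.1 hza)
    simp only [Set.mem_ofPred_eq] at hz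
    linarith
  calc _ ≤ μ.real (Set.Iic a)ᶜ := measureReal_mono hsub
    _ = s := by
      rw [probReal_compl_eq_one_sub measurableSet_Iic, ← ProbabilityTheory.cdf_eq_real, ha]
      ring

/-- Union bound before the limit: the `j`-th event has probability at most `t x_j`. -/
theorem IsStdf.abs_le_sum {d : ℕ} {ℓ : (Fin d → ℝ) → ℝ} (hℓ : IsStdf ℓ) {x : Fin d → ℝ}
    (hx : 0 ≤ x) : |ℓ x| ≤ ∑ j, x j := by
  obtain ⟨μ, hμ, hc, hlim⟩ := hℓ
  have h := hlim x hx
  have hbound : ∀ᶠ t : ℝ in 𝓝[>] 0, |t⁻¹ * μ.real {z | ∃ j, 1 - t * x j <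
      ProbabilityTheory.cdf (μ.map fun z => z j) (z j)}| ≤ ∑ j, x j := by
    filter_upwards [self_mem_nhdsWithin] with t (ht : 0 < t)
    rw [abs_of_nonneg (by positivity), inv_mul_le_iff₀ ht, Finset.mul_sum]
    rw [Set.ofPred_exists]
    refine (measureReal_iUnion_fintype_le _).trans (Finset.sum_le_sum fun j _ => ?_)
    have : IsProbabilityMeasure (μ.map fun z => z j) :=
      Measure.isProbabilityMeasure_map (measurable_pi_apply j).aemeasurable
    have hm := measureReal_one_sub_lt_cdf_le (μ.map fun z => z j) (hc j)
      (mul_nonneg ht.le (hx j))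
    rwa [map_measureReal_apply (measurable_pi_apply j)
      (measurableSet_lt measurable_const (hc j).measurable)] at hm
  exact le_of_tendsto h.abs hbound

/-! ### Concentration of the binomial kernel. -/

theorem integral_exp_binomial_le (n : ℕ) (p : unitInterval) (θ : ℝ) :
    ∫ t, Real.exp (θ * (t : ℝ)) ∂(ProbabilityTheory.binomial n p) ≤
      Real.exp (n * p * (Real.exp θ - 1)) := by
  have h : ∫ t, Real.exp (θ * (t : ℝ)) ∂(ProbabilityTheory.binomial n p) =
      (p * Real.exp θ + (1 - p)) ^ n := by
    rw [ProbabilityTheory.integral_binomial, add_pow, Nat.range_succ_eq_Iic]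
    refine Finset.sum_congr rfl fun i _ => ?_
    rw [smul_eq_mul, mul_pow, mul_comm θ, Real.exp_nat_mul]
    ring
  have hp := p.2.1
  have hp1 := p.2.2
  rw [h, mul_assoc, Real.exp_nat_mul]
  refine pow_le_pow_left₀ (by have := Real.exp_pos θ; nlinarith) ?_ n
  have := Real.add_one_le_exp (p * (Real.exp θ - 1))
  linarith

theorem Real.exp_sub_one_sub_id_le_sq {θ : ℝ} (h : |θ| ≤ 1) : Real.exp θ - 1 - θ ≤ θ ^ 2 :=
  (le_abs_self _).trans (Real.abs_exp_sub_one_sub_id_le h)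

/-- Chernoff bound for a binomial variable with mean `k x ≤ k`, at relative deviation `r`. -/
theorem binomial_abs_sub_gt_le {n : ℕ} {p : unitInterval} {k x r : ℝ} (hk : 0 < k)
    (hx0 : 0 ≤ x) (hx1 : x ≤ 1) (hp : n * (p : ℝ) = k * x) (hr0 : 0 < r) (hr1 : r ≤ 1) :
    (ProbabilityTheory.binomial n p).real {t : ℕ | r < |(t : ℝ) / k - x|} ≤
      2 * Real.exp (-(k * r ^ 2 / 4)) := by
  have hsub : {t : ℕ | r < |(t : ℝ) / k - x|} ⊆
      {t : ℕ | k * (x + r) ≤ (t : ℝ)} ∪ {t : ℕ | (t : ℝ) ≤ k * (x - r)} := by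
    intro t ht
    rcases lt_abs.1 ht.out with h | h
    · left
      have : x + r ≤ (t : ℝ) / k := by linarith
      rw [le_div_iff₀ hk] at this
      simp only [Set.mem_ofPred_eq]
      linarith
    · right
      have : (t : ℝ) / k ≤ x - r := by linarith
      rw [div_le_iff₀ hk] at this
      simp only [Set.mem_ofPred_eq]
      linarith
  have key : ∀ θ : ℝ, |θ| ≤ 1 → ∫ t : ℕ, Real.exp (θ * (t : ℝ)) ∂(ProbabilityTheory.binomial n p) ≤
      Real.exp (k * x * θ + k * θ ^ 2) := by
    intro θ hθ
    refine (integral_exp_binomial_le n p θ).trans (Real.exp_le_exp.2 ?_)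
    rw [hp]
    have h1 := Real.exp_sub_one_sub_id_le_sq hθ
    have h2 : k * x * (Real.exp θ - 1 - θ) ≤ k * x * θ ^ 2 := by gcongr
    have h3 : k * x * θ ^ 2 ≤ k * 1 * θ ^ 2 := by gcongr
    linarith
  -- `θ = ±r/2` minimizes the exponent `kθ² - k r |θ|`, with minimum `-k r²/4`.
  have hup := ProbabilityTheory.measure_ge_le_exp_mul_mgf (μ := ProbabilityTheory.binomial n p)
    (X := fun t : ℕ => (t : ℝ)) (t := r / 2) (k * (x + r)) (by positivity)
    (ProbabilityTheory.integrable_binomial _)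
  have hlo := ProbabilityTheory.measure_le_le_exp_mul_mgf (μ := ProbabilityTheory.binomial n p)
    (X := fun t : ℕ => (t : ℝ)) (t := -(r / 2)) (k * (x - r)) (by linarith)
    (ProbabilityTheory.integrable_binomial _)
  have k1 := key (r / 2) (by rw [abs_of_pos (by positivity)]; linarith)
  have k2 := key (-(r / 2)) (by rw [abs_neg, abs_of_pos (by positivity)]; linarith)
  refine (measureReal_mono hsub).trans ((measureReal_union_le _ _).trans ?_)
  have e1 : Real.exp (-(r / 2) * (k * (x + r))) * Real.exp (k * x * (r / 2) + k * (r / 2) ^ 2) =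
      Real.exp (-(k * r ^ 2 / 4)) := by
    rw [← Real.exp_add]; congr 1; ring
  have e2 : Real.exp (-(-(r / 2)) * (k * (x - r))) *
      Real.exp (k * x * (-(r / 2)) + k * (-(r / 2)) ^ 2) = Real.exp (-(k * r ^ 2 / 4)) := by
    rw [← Real.exp_add]; congr 1; ring
  have u1 := hup.trans ((mul_le_mul_of_nonneg_left k1 (Real.exp_pos _).le).trans_eq e1)
  have u2 := hlo.trans ((mul_le_mul_of_nonneg_left k2 (Real.exp_pos _).le).trans_eq e2)
  linarith

theorem binomial_ae_le (n : ℕ) (p : unitInterval) :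
    ∀ᵐ t ∂(ProbabilityTheory.binomial n p), t ≤ n :=
  ProbabilityTheory.ae_le_of_hasLaw_binomial (X := id) ProbabilityTheory.HasLaw.id

/-- Integral against `betaKernel` of an arbitrary function that is `ε`-close to its value at `x`
near `x` and differs from it by at most `M` elsewhere. -/
theorem abs_setIntegral_betaKernel_sub_le {d n : ℕ} {k : ℝ} (hk : 0 < k) (hkn : k ≤ n)
    {x : Fin d → ℝ} (hx : x ∈ box d 1) {r : ℝ} (hr0 : 0 < r) (hr1 : r ≤ 1) {ε M : ℝ}
    (hε : 0 ≤ ε) (hM : 0 ≤ M) (b : (Fin d → ℝ) → ℝ)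
    (hnear : ∀ y ∈ box d (n / k), dist y x ≤ r → |b y - b x| ≤ ε)
    (hfar : ∀ y ∈ box d (n / k), |b y - b x| ≤ M) :
    |(∫ y in box d (n / k), b y ∂(betaKernel n k x)) - b x| ≤
      ε + M * (d * (2 * Real.exp (-(k * r ^ 2 / 4)))) := by
  set p : Fin d → unitInterval := fun j => Set.projIcc (0 : ℝ) 1 zero_le_one (k / n * x j) with hp
  set μ : Measure (Fin d → ℕ) := Measure.pi fun j => ProbabilityTheory.binomial n (p j) with hμ
  set φ : (Fin d → ℕ) → (Fin d → ℝ) := fun t j => (t j : ℝ) / k with hφ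
  have hn : (0 : ℝ) < n := hk.trans_le hkn
  have hinj : Function.Injective φ := fun s t hst => funext fun j => by
    have := congrFun hst j
    simp only [hφ] at this
    field_simp at this
    exact_mod_cast this
  -- The kernel lives on a countable lattice, so the change of variables and integrability need no
  -- measurability of `b`.
  have hemb : MeasurableEmbedding φ :=
    ⟨hinj, measurable_of_countable _, fun {s} _ => ((Set.to_countable s).image φ).measurableSet⟩
  have hbox : ∀ᵐ t ∂μ, φ t ∈ box d (n / k) := by
    have : ∀ j, ∀ᵐ t ∂μ, t j ≤ n := fun j =>
      (measurePreserving_eval (fun j => ProbabilityTheory.binomial n (p j)) j).quasiMeasurePreserving.ae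
        (binomial_ae_le n (p j))
    filter_upwards [ae_all_iff.2 this] with t ht
    refine ⟨fun j => by simp only [hφ, Pi.zero_apply]; positivity, fun j => ?_⟩
    simp only [hφ]
    gcongr
    exact ht j
  have hint : ∫ y in box d (n / k), b y ∂(betaKernel n k x) = ∫ t, b (φ t) ∂μ := by
    have : betaKernel n k x = μ.map φ := rfl
    rw [this, hemb.setIntegral_map]
    rw [Measure.restrict_eq_self_of_ae_mem]
    exact hbox
  set A : Set (Fin d → ℕ) := {t | r < dist (φ t) x} with hA
  have hAp : μ.real A ≤ d * (2 * Real.exp (-(k * r ^ 2 / 4))) := by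
    have hsub : A ⊆ ⋃ j, {t | r < |(t j : ℝ) / k - x j|} := by
      intro t ht
      by_contra hcon
      simp only [Set.mem_iUnion, Set.mem_ofPred_eq, not_exists, not_lt] at hcon
      exact absurd ht.out (not_lt.2 ((dist_pi_le_iff hr0.le).2 hcon))
    refine (measureReal_mono hsub).trans ((measureReal_iUnion_fintype_le _).trans ?_)
    refine (Finset.sum_le_card_nsmul _ _ (2 * Real.exp (-(k * r ^ 2 / 4))) fun j _ => ?_).trans
      (by simp)
    have h := (measurePreserving_eval (fun j => ProbabilityTheory.binomial n (p j)) j)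
    have hmeas : MeasurableSet {t : ℕ | r < |(t : ℝ) / k - x j|} := .of_discrete
    have h0 : 0 ≤ x j := hx.1 j
    have h1 : x j ≤ 1 := hx.2 j
    have heq : μ.real {t | r < |(t j : ℝ) / k - x j|} =
        (ProbabilityTheory.binomial n (p j)).real {t : ℕ | r < |(t : ℝ) / k - x j|} := by
      rw [measureReal_def, measureReal_def, ← h.measure_preimage hmeas.nullMeasurableSet]
      rfl
    rw [heq]
    refine binomial_abs_sub_gt_le hk h0 h1 ?_ hr0 hr1
    have hmem : k / n * x j ∈ Set.Icc (0 : ℝ) 1 := by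
      refine ⟨by positivity, mul_le_one₀ ?_ h0 h1⟩
      rwa [div_le_one hn]
    simp only [hp, Set.projIcc_of_mem _ hmem]
    field_simp
  have hAm : MeasurableSet A := .of_discrete
  have hdiff : ∀ᵐ t ∂μ, ‖b (φ t) - b x‖ ≤ ε + A.indicator (fun _ => M) t := by
    filter_upwards [hbox] with t ht
    rw [Real.norm_eq_abs]
    by_cases htA : t ∈ A
    · rw [Set.indicator_of_mem htA]
      linarith [hfar _ ht]
    · rw [Set.indicator_of_notMem htA, add_zero]
      exact hnear _ ht (not_lt.1 htA)
  have hgi : Integrable (fun t => ε + A.indicator (fun _ => M) t) μ :=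
    (integrable_const _).add ((integrable_const _).indicator hAm)
  have hdi : Integrable (fun t => b (φ t) - b x) μ :=
    hgi.mono' (measurable_of_countable _).aestronglyMeasurable hdiff
  have hbi : Integrable (fun t => b (φ t)) μ := by
    refine (hdi.add (integrable_const (b x))).congr (ae_of_all _ fun t => ?_)
    simp
  have hsplit : (∫ t, b (φ t) ∂μ) - b x = ∫ t, (b (φ t) - b x) ∂μ := by
    rw [integral_sub hbi (integrable_const _)]
    simp
  rw [hint, hsplit, ← Real.norm_eq_abs]
  refine (norm_integral_le_of_norm_le hgi hdiff).trans ?_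
  rw [integral_add (integrable_const _) ((integrable_const _).indicator hAm),
    integral_indicator_const _ hAm]
  simp only [integral_const, probReal_univ, smul_eq_mul, one_mul]
  rw [mul_comm M]
  gcongr

/-! ### Modulus of continuity on `ℓ^∞`. -/

/-- The modulus of continuity `sup {|z s - z t| : dist s t ≤ r}`. -/
noncomputable def modulusOfContinuity {T : Type*} [PseudoMetricSpace T] (r : ℝ) (z : LInfty T) : ℝ :=
  ⨆ p : {p : T × T // dist p.1 p.2 ≤ r}, |z p.1.1 - z p.1.2|

theorem LInfty.abs_apply_le_norm {T : Type*} (z : LInfty T) (s : T) : |z s| ≤ ‖z‖ :=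
  lp.norm_apply_le_norm ENNReal.top_ne_zero z s

theorem LInfty.abs_sub_le_two_norm {T : Type*} (z : LInfty T) (s t : T) : |z s - z t| ≤ 2 * ‖z‖ := by
  have h := abs_sub (z s) (z t)
  have hs := LInfty.abs_apply_le_norm z s
  have ht := LInfty.abs_apply_le_norm z t
  linarith

section ModulusOfContinuity
variable {T : Type*} [PseudoMetricSpace T]

theorem abs_sub_le_modulusOfContinuity {r : ℝ} (z : LInfty T) {s t : T} (h : dist s t ≤ r) :
    |z s - z t| ≤ modulusOfContinuity r z :=
  le_ciSup (f := fun p : {p : T × T // dist p.1 p.2 ≤ r} => |z p.1.1 - z p.1.2|)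
    ⟨2 * ‖z‖, by rintro _ ⟨p, rfl⟩; exact LInfty.abs_sub_le_two_norm z _ _⟩ ⟨(s, t), h⟩

/-- `0 ≤ a` covers an empty index set, where the real supremum is 0 by default. -/
theorem modulusOfContinuity_le {r a : ℝ} {z : LInfty T} (ha : 0 ≤ a)
    (h : ∀ s t : T, dist s t ≤ r → |z s - z t| ≤ a) : modulusOfContinuity r z ≤ a :=
  Real.iSup_le (fun p => h _ _ p.2) ha

theorem modulusOfContinuity_nonneg (r : ℝ) (z : LInfty T) : 0 ≤ modulusOfContinuity r z :=
  Real.iSup_nonneg fun _ => abs_nonneg _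

/-- Gives the Lipschitz continuity that lets weak convergence be tested on the modulus. -/
theorem modulusOfContinuity_le_add (r : ℝ) (z w : LInfty T) :
    modulusOfContinuity r z ≤ modulusOfContinuity r w + 2 * dist z w := by
  refine modulusOfContinuity_le (by have := modulusOfContinuity_nonneg r w; positivity) fun s t hst => ?_
  have h1 := abs_sub_le_modulusOfContinuity w hst
  have h2 := LInfty.abs_sub_le_two_norm (z - w) s t
  rw [← dist_eq_norm] at h2
  have h3 : z s - z t = (w s - w t) + ((z - w) s - (z - w) t) := by
    simp only [lp.coeFn_sub, Pi.sub_apply]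
    ring
  rw [h3]
  exact (abs_add_le _ _).trans (add_le_add h1 h2)

theorem continuous_modulusOfContinuity (r : ℝ) : Continuous (modulusOfContinuity r : LInfty T → ℝ) :=
  (LipschitzWith.of_le_add_mul 2 fun z w => by simpa using modulusOfContinuity_le_add r z w).continuous

theorem tendsto_modulusOfContinuity_zero [CompactSpace T] {z : LInfty T} (hz : Continuous fun t => z t) :
    Tendsto (fun m : ℕ => modulusOfContinuity (1 / ((m : ℝ) + 1)) z) atTop (𝓝 0) := by
  rw [Metric.tendsto_atTop]
  intro ε hε
  obtain ⟨r, hr, h⟩ := Metric.uniformContinuous_iff.1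
    (CompactSpace.uniformContinuous_of_continuous hz) (ε / 2) (half_pos hε)
  obtain ⟨N, hN⟩ := exists_nat_one_div_lt hr
  refine ⟨N, fun m hm => ?_⟩
  have hmN : 1 / ((m : ℝ) + 1) ≤ 1 / ((N : ℝ) + 1) := by gcongr
  rw [Real.dist_eq, sub_zero, abs_of_nonneg (modulusOfContinuity_nonneg _ _)]
  have : modulusOfContinuity (1 / ((m : ℝ) + 1)) z ≤ ε / 2 :=
    modulusOfContinuity_le (half_pos hε).le fun s t hst => (h (by linarith)).le
  linarith

/-- `min 1 (modulusOfContinuity r z / ε)` as a bounded continuous function of `z`. -/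
noncomputable def truncatedModulus (r ε : ℝ) : LInfty T →ᵇ ℝ :=
  BoundedContinuousFunction.ofNormedAddCommGroup (fun z => min 1 (|modulusOfContinuity r z / ε|))
    (continuous_const.min ((continuous_modulusOfContinuity r).div_const ε).abs) 1 fun z => by
      rw [Real.norm_eq_abs, abs_of_nonneg (by positivity)]
      exact min_le_left _ _

end ModulusOfContinuity

/-! ### Asymptotic equicontinuity in outer probability. -/

/-- Markov's inequality for each measurable majorant; `A` may be non-measurable. -/
theorem measureReal_le_outerExpectation {Ω : Type*} [MeasurableSpace Ω] (P : Measure Ω)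
    [IsProbabilityMeasure P] {g : Ω → ℝ} (h0 : ∀ ω, 0 ≤ g ω) (h1 : ∀ ω, g ω ≤ 1) {A : Set Ω}
    (hA : ∀ ω ∈ A, 1 ≤ g ω) : P.real A ≤ outerExpectation P g := by
  refine le_csInf ⟨_, fun _ => 1, measurable_const, integrable_const _, h1, rfl⟩ ?_
  rintro _ ⟨U, -, hUi, hgU, rfl⟩
  have hm := mul_meas_ge_le_integral_of_nonneg (ae_of_all P fun ω => (h0 ω).trans (hgU ω)) hUi 1
  rw [one_mul] at hm
  exact (measureReal_mono fun ω hω => (hA ω hω).trans (hgU ω)).trans hm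

/-- Weak convergence to a limit with continuous trajectories on a compact space implies asymptotic
equicontinuity in outer probability. -/
theorem ConvergesWeakly.eventually_modulusOfContinuity {T : Type*} [PseudoMetricSpace T] [CompactSpace T]
    {Ω : ℕ → Type*} [∀ n, MeasurableSpace (Ω n)] {P : ∀ n, Measure (Ω n)}
    [∀ n, IsProbabilityMeasure (P n)] {Z : ∀ n, Ω n → LInfty T}
    {Ω' : Type*} [MeasurableSpace Ω'] {Q : Measure Ω'} [IsProbabilityMeasure Q]
    {B : Ω' → LInfty T} (hB : ∀ ω, Continuous fun t => B ω t) (h : ConvergesWeakly P Z Q B)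
    {ε η : ℝ} (hε : 0 < ε) (hη : 0 < η) :
    ∀ᶠ m : ℕ in atTop, ∀ᶠ n in atTop,
      (P n).real {ω | ε < modulusOfContinuity (1 / ((m : ℝ) + 1)) (Z n ω)} ≤ η := by
  obtain ⟨hBm, hconv⟩ := h
  set f : ℕ → LInfty T →ᵇ ℝ := fun m => truncatedModulus (1 / ((m : ℝ) + 1)) ε with hf
  have hfapp : ∀ m z, f m z = min 1 (|modulusOfContinuity (1 / ((m : ℝ) + 1)) z / ε|) := fun m z => rfl
  have hf0 : ∀ m z, 0 ≤ f m z := fun m z => by rw [hfapp]; positivity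
  have hf1 : ∀ m z, f m z ≤ 1 := fun m z => min_le_left _ _
  have hmeas : ∀ m, Measurable fun ω => f m (B ω) := fun m => by
    let : MeasurableSpace (LInfty T) := borel _
    have : BorelSpace (LInfty T) := ⟨rfl⟩
    exact (f m).continuous.measurable.comp hBm
  have hlim : Tendsto (fun m => ∫ ω, f m (B ω) ∂Q) atTop (𝓝 (∫ _, (0 : ℝ) ∂Q)) := by
    refine tendsto_integral_of_dominated_convergence (fun _ => 1)
      (fun m => (hmeas m).aestronglyMeasurable) (integrable_const _)
      (fun m => ae_of_all _ fun ω => ?_) (ae_of_all _ fun ω => ?_)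
    · rw [Real.norm_eq_abs, abs_of_nonneg (hf0 _ _)]
      exact hf1 _ _
    · have := (tendsto_const_nhds (x := (1 : ℝ))).min
        ((tendsto_modulusOfContinuity_zero (hB ω)).div_const ε).abs
      simpa [hfapp] using this
  rw [integral_zero] at hlim
  -- The scale `m` is fixed through the limit `B` first; only then does `n` grow.
  filter_upwards [hlim.eventually_lt_const hη] with m hm
  filter_upwards [(hconv (f m)).eventually_lt_const hm] with n hn
  refine (measureReal_le_outerExpectation (P n) (fun ω => hf0 m _) (fun ω => hf1 m _) ?_).trans hn.le
  intro ω hω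
  rw [hfapp]
  refine le_min le_rfl (le_trans ?_ (le_abs_self _))
  rw [le_div_iff₀ hε, one_mul]
  exact hω.out.le

/-! ### The far contribution and the conclusion. -/

/-- Eventually `k c ≥ 2 log n`, so the exponential is at most `n⁻²`, and `k ≥ log n ≥ 1`, so the
prefactor is at most `n`. -/
theorem eventually_sqrt_mul_div_mul_exp_le {k : ℕ → ℝ}
    (hlog : (fun n : ℕ => Real.log n) =o[atTop] k) (hk : ∀ n : ℕ, 1 ≤ n → 0 < k n)
    {c C ε : ℝ} (hc : 0 < c) (hC : 0 ≤ C) (hε : 0 < ε) :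
    ∀ᶠ n : ℕ in atTop, C * (√(k n) * (n / k n) * Real.exp (-(k n * c))) ≤ ε := by
  have hlog_top : Tendsto (fun n : ℕ => Real.log n) atTop atTop :=
    Real.tendsto_log_atTop.comp tendsto_natCast_atTop_atTop
  have hCn : Tendsto (fun n : ℕ => C / (n : ℝ)) atTop (𝓝 0) := tendsto_const_div_atTop_nhds_zero_nat C
  filter_upwards [hlog.bound (half_pos hc), hlog.bound one_pos, hlog_top.eventually_ge_atTop 1,
    hCn.eventually_le_const hε, eventually_ge_atTop 1] with n h1 h2 h3 h4 h5
  have hkn := hk n h5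
  have hn : (0 : ℝ) < n := by exact_mod_cast h5
  rw [Real.norm_eq_abs, Real.norm_eq_abs, abs_of_nonneg (by linarith), abs_of_pos hkn] at h1 h2
  have hk1 : 1 ≤ k n := by linarith
  have hsq : √(k n) * (n / k n) ≤ n := by
    have : √(k n) ≤ k n := by
      rw [Real.sqrt_le_left hkn.le]
      nlinarith
    calc √(k n) * (n / k n) ≤ k n * (n / k n) := by gcongr
      _ = n := by field_simp
  have hexp : Real.exp (-(k n * c)) ≤ ((n : ℝ) ^ 2)⁻¹ := by
    rw [← Real.exp_log hn, ← Real.exp_nat_mul, ← Real.exp_neg, Real.exp_le_exp]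
    push_cast
    linarith
  calc C * (√(k n) * (n / k n) * Real.exp (-(k n * c))) ≤ C * (n * ((n : ℝ) ^ 2)⁻¹) := by gcongr
    _ = C / n := by field_simp
    _ ≤ ε := h4

/-- On the box, the error process is bounded in terms of a bound on the estimator. -/
theorem abs_scaledError_le {d : ℕ} {Ω : ℕ → Type*} {k : ℕ → ℝ}
    {ℓhat : ∀ n, Ω n → (Fin d → ℝ) → ℝ} {ℓ : (Fin d → ℝ) → ℝ} (hℓ : IsStdf ℓ) {n : ℕ} {ω : Ω n}
    {a M : ℝ} {y : Fin d → ℝ} (hy : y ∈ box d a) (hM : |ℓhat n ω y| ≤ M * a) :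
    |(errorProcess k ℓhat ℓ n ω y)| ≤ √(k n) * ((M + d) * a) := by
  have hsum : ∑ j, y j ≤ d * a :=
    (Finset.sum_le_card_nsmul _ _ a fun j _ => hy.2 j).trans (by simp)
  have h1 := hℓ.abs_le_sum hy.1
  have h2 := abs_sub (ℓhat n ω y) (ℓ y)
  rw [errorProcess, abs_mul, abs_of_nonneg (Real.sqrt_nonneg _)]
  gcongr
  linarith

theorem mainTheorem2 {d : ℕ}
    {Ω : ℕ → Type*} [∀ n, MeasurableSpace (Ω n)]
    (P : ∀ n, Measure (Ω n)) [∀ n, IsProbabilityMeasure (P n)]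
    {Ω' : Type*} [MeasurableSpace Ω'] (Q : Measure Ω') [IsProbabilityMeasure Q]
    (ℓ : (Fin d → ℝ) → ℝ) (hℓ : IsStdf ℓ)
    (ℓhat : ∀ n, Ω n → (Fin d → ℝ) → ℝ)
    (k : ℕ → ℝ) (hk : ∀ n : ℕ, 1 ≤ n → 0 < k n ∧ k n ≤ n)
    (hlog : (fun n : ℕ => Real.log n) =o[atTop] k)
    (hkn : k =o[atTop] fun n : ℕ => (n : ℝ))
    (hgrowth : GrowthCondition P k ℓhat)
    (hweak : WeakConvergenceCondition P Q k ℓhat ℓ) :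
    IsLittleOOneInProb P fun n ω =>
      ⨆ x ∈ box d 1,
        ‖(∫ y in box d (n / k n), errorProcess k ℓhat ℓ n ω y ∂(betaKernel n (k n) x)) -
          errorProcess k ℓhat ℓ n ω x‖ₑ := by
  intro ε hε
  obtain ⟨δ, hδ, B, hBc, Z, hZ, hconv⟩ := hweak
  have : CompactSpace (box d (1 + δ)) := isCompact_iff_compactSpace.1 isCompact_Icc
  rw [ENNReal.tendsto_nhds_zero]
  intro η' hη'
  obtain ⟨η, hη0, hηle⟩ : ∃ η : ℝ, 0 < η ∧ ENNReal.ofReal η ≤ η' := by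
    obtain ⟨q, hq0, hq⟩ := ENNReal.lt_iff_exists_nnreal_btwn.1 hη'
    exact ⟨q, by exact_mod_cast hq0, by simpa using hq.le⟩
  obtain ⟨M₀, hM₀⟩ := hgrowth (η / 2) (half_pos hη0)
  -- `M₀` may be negative.
  set M := |M₀|
  have hM : 0 ≤ M := abs_nonneg _
  have hsmall : ∀ᶠ m : ℕ in atTop, 1 / ((m : ℝ) + 1) ≤ δ :=
    tendsto_one_div_add_atTop_nhds_zero_nat.eventually_le_const hδ
  obtain ⟨m, hm, hmδ⟩ :=
    ((hconv.eventually_modulusOfContinuity hBc (half_pos hε) (half_pos hη0)).and hsmall).exists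
  set r : ℝ := 1 / ((m : ℝ) + 1) with hr
  have hr0 : 0 < r := by positivity
  have hr1 : r ≤ 1 := by
    rw [hr, div_le_one (by positivity)]
    linarith [m.cast_nonneg (α := ℝ)]
  -- In `C`, `2 (M + d)` comes from bounding the error at two points and `d * 2` from the tail bound
  -- over `d` coordinates.
  have hneg := eventually_sqrt_mul_div_mul_exp_le hlog (fun n hn => (hk n hn).1)
    (c := r ^ 2 / 4) (C := 2 * (M + d) * (d * 2)) (by positivity) (by positivity) (half_pos hε)
  filter_upwards [hm, hM₀, hneg, hZ, eventually_ge_atTop 1] with n hosc hgr hng hZn hn1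
  obtain ⟨hk0, hkle⟩ := hk n hn1
  have hn0 : (0 : ℝ) < n := by exact_mod_cast hn1
  have hbox1 : 1 ≤ n / k n := by rwa [one_le_div hk0]
  -- Outside these two bad events the bound is deterministic; monotonicity and subadditivity hold
  -- for outer measure.
  refine (measure_mono (t := {ω | ε / 2 < modulusOfContinuity r (Z n ω)} ∪ {ω | ENNReal.ofReal
    (M₀ * (n / k n)) < ⨆ y ∈ box d (n / k n), ‖ℓhat n ω y‖ₑ}) ?_).trans ?_
  · intro ω hω
    by_contra hcon
    simp only [Set.mem_union, Set.mem_ofPred_eq, not_or, not_lt] at hcon hω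
    obtain ⟨hc1, hc2⟩ := hcon
    refine absurd hω (not_lt.2 (iSup₂_le fun x hx => ?_))
    have hℓM : ∀ y ∈ box d (n / k n), |ℓhat n ω y| ≤ M * (n / k n) := by
      intro y hy
      have h := (le_iSup₂ (f := fun y (_ : y ∈ box d (n / k n)) => ‖ℓhat n ω y‖ₑ) y hy).trans hc2
      have h' := h.trans (ENNReal.ofReal_le_ofReal
        (mul_le_mul_of_nonneg_right (le_abs_self M₀) (by positivity)))
      rw [Real.enorm_eq_ofReal_abs] at h'
      exact (ENNReal.ofReal_le_ofReal_iff (by positivity)).1 h'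
    have hbd : ∀ y ∈ box d (n / k n),
        |(errorProcess k ℓhat ℓ n ω y)| ≤ √(k n) * ((M + d) * (n / k n)) :=
      fun y hy => abs_scaledError_le hℓ hy (hℓM y hy)
    have hxn : x ∈ box d (n / k n) := ⟨hx.1, fun j => (hx.2 j).trans hbox1⟩
    have hx' : x ∈ box d (1 + δ) := ⟨hx.1, fun j => (hx.2 j).trans (by linarith)⟩
    rw [Real.enorm_eq_ofReal_abs]
    refine ENNReal.ofReal_le_ofReal ?_
    refine (abs_setIntegral_betaKernel_sub_le hk0 hkle hx hr0 hr1 (ε := ε / 2)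
      (M := 2 * (√(k n) * ((M + d) * (n / k n)))) (by positivity) (by positivity) _
      ?_ ?_).trans ?_
    · intro y hy hyx
      -- `r ≤ δ` keeps the near points inside the box of weak convergence.
      have hy' : y ∈ box d (1 + δ) := by
        refine ⟨hy.1, fun j => ?_⟩
        have h1 := (dist_le_pi_dist y x j).trans hyx
        have h2 : x j ≤ 1 := hx.2 j
        rw [Real.dist_eq] at h1
        have h3 := le_abs_self (y j - x j)
        linarith
      have h := (abs_sub_le_modulusOfContinuity (Z n ω) (s := ⟨y, hy'⟩) (t := ⟨x, hx'⟩) hyx).trans hc1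
      rwa [hZn, hZn] at h
    · intro y hy
      have h1 := abs_sub (errorProcess k ℓhat ℓ n ω y) (errorProcess k ℓhat ℓ n ω x)
      linarith [hbd y hy, hbd x hxn]
    · rw [← mul_div_assoc (k n)] at hng
      calc _ = ε / 2 + 2 * (M + d) * (d * 2) * (√(k n) * (n / k n) *
            Real.exp (-(k n * r ^ 2 / 4))) := by ring
        _ ≤ ε / 2 + ε / 2 := by gcongr
        _ = ε := add_halves ε
  · refine (measure_union_le _ _).trans (le_trans ?_ hηle)
    rw [← add_halves η, ENNReal.ofReal_add (by positivity) (by positivity)]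
    refine add_le_add ?_ hgr
    rw [← ofReal_measureReal]
    exact ENNReal.ofReal_le_ofReal hosc
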